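/- Let $n,k\ge 0$ be integers. For a partition $\mu$, let $\mathrm{SSYT}(\mu,n)$ be the set of fillings of the Young diagram of $\mu$ with numbers in $[n]=\{1,\dots,n\}$ that are weakly increasing along rows and strictly increasing down columns, and let $$s_\mu(x_1,\dots,x_n)=\sum_{T\in \mathrm{SSYT}(\mu,n)}\ \prod_{m=1}^n x_m^{\mathrm{wt}_m(T)}\in\mathbb{Z}[x_1,\dots,x_n]$$ be the Schur polynomial, where $\mathrm{wt}_m(T)$ is the number of cells of $T$ labelled $m$. Put $$\overline{s}_\mu(x_1,\dots,x_n)=s_\mu(p_1-x_1,\dots,p_1-x_n),\qquad p_1=x_1+\cdots+x_n .$$ Let $\mathrm{SYT}(\mu,n)$ be the set of $T\in\mathrm{SSYT}(\mu,n)$ that use each value at most once and are strictly increasing along rows (so the labels are distinct elements of $[n]$, not necessarily $1,\dots,|\mu|$), and let $P(\mu,n)$ (the parity tableaux) be the set of $T\in \mathrm{SYT}(\mu,n)$ such that the smallest positive integer that does not appear as a label in the first column of $T$ is odd; this integer need not be a label of $T$, and it may be $n+1$. Then $$\overline{s}_{(1^k)}(x_1,\dots,x_n)=\sum_{|\mu|=k}|P(\mu,n)|\,s_\mu(x_1,\dots,x_n),$$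 where $(1^k)$ is the partition consisting of $k$ ones and the sum is over all partitions $\mu$ of $k$. -/

import Mathlib

namespace ChernPlethysm

open MvPolynomial

/-- `SSYT(μ, n)`: the semistandard Young tableaux of shape `μ` all of whose labels lie in
`[n] = {1, …, n}`.  (Rows and columns are indexed from `0`, the labels are not shifted; Mathlib's
`SemistandardYoungTableau` assigns the dummy value `0` to the positions outside `μ`.) -/
def SSYT (μ : YoungDiagram) (n : ℕ) : Set (SemistandardYoungTableau μ) :=
  {T | ∀ i j, (i, j) ∈ μ → 1 ≤ T i j ∧ T i j ≤ n}

theorem SSYT_finite (μ : YoungDiagram) (n : ℕ) : (SSYT μ n).Finite := by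
  classical
  let f : SemistandardYoungTableau μ → (μ.cells → ℕ) := fun T c => T c.1.1 c.1.2
  have hf : Function.Injective f := by
    intro T T' h
    ext i j
    by_cases hc : (i, j) ∈ μ
    · exact congrFun h ⟨(i, j), (YoungDiagram.mem_cells (i, j)).2 hc⟩
    · rw [T.zeros hc, T'.zeros hc]
  have hfin : (Set.pi Set.univ (fun _ : μ.cells => Set.Icc 1 n)).Finite :=
    Set.Finite.pi' (fun _ => Set.finite_Icc 1 n) |>.subset (fun g hg c => hg c (Set.mem_univ c))
  refine Set.Finite.of_finite_image (f := f) (hfin.subset ?_) hf.injOn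
  rintro _ ⟨T, hT, rfl⟩ c _
  exact hT c.1.1 c.1.2 ((YoungDiagram.mem_cells _).1 c.2)

/-- `wt_m(T)`: the number of cells of `T` that carry the label `m`. -/
def wt {μ : YoungDiagram} (T : SemistandardYoungTableau μ) (m : ℕ) : ℕ :=
  (μ.cells.filter (fun c => T c.1 c.2 = m)).card

/-- The Schur polynomial `s_μ(x_1, …, x_n) = ∑_{T ∈ SSYT(μ, n)} ∏_{m = 1}^n x_m ^ wt_m(T)`.
The variable `x_{i+1}` is `X i` for `i : Fin n`. -/
noncomputable def schur (μ : YoungDiagram) (n : ℕ) : MvPolynomial (Fin n) ℤ :=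
  ∑ T ∈ (SSYT_finite μ n).toFinset, ∏ i : Fin n, X i ^ wt T ((i : ℕ) + 1)

/-- `s̄_μ(x_1, …, x_n) = s_μ(p₁ - x_1, …, p₁ - x_n)`, where `p₁ = x_1 + ⋯ + x_n`. -/
noncomputable def schurBar (μ : YoungDiagram) (n : ℕ) : MvPolynomial (Fin n) ℤ :=
  aeval (fun i : Fin n => (∑ j : Fin n, X j) - X i : Fin n → MvPolynomial (Fin n) ℤ) (schur μ n)

/-- The one-column partition `(1^k) = (1, …, 1)`. -/
def column (k : ℕ) : YoungDiagram :=
  YoungDiagram.ofRowLens (List.replicate k 1)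
    (List.pairwise_replicate_of_refl (R := (· ≥ ·)) |>.sortedGE)

/-- `SYT(μ, n)`: the tableaux in `SSYT(μ, n)` that use each label at most once and are strictly
increasing along rows.  Labels larger than the number of cells are allowed. -/
def SYT (μ : YoungDiagram) (n : ℕ) : Set (SemistandardYoungTableau μ) :=
  {T | T ∈ SSYT μ n ∧
    (∀ c ∈ μ, ∀ d ∈ μ, T c.1 c.2 = T d.1 d.2 → c = d) ∧
    (∀ i j₁ j₂, j₁ < j₂ → (i, j₂) ∈ μ → T i j₁ < T i j₂)}

/-- The positive integers that do not appear as labels in the first column of `T`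
(whether or not they appear elsewhere in `T`). -/
def missingFirstColumn {μ : YoungDiagram} (T : SemistandardYoungTableau μ) : Set ℕ :=
  {m | 1 ≤ m ∧ ∀ i, (i, 0) ∈ μ → T i 0 ≠ m}

/-- The parity tableaux `P(μ, n)`: the tableaux in `SYT(μ, n)` such that the smallest positive
integer not appearing in the first column is odd. -/
def parityTableaux (μ : YoungDiagram) (n : ℕ) : Set (SemistandardYoungTableau μ) :=
  {T | T ∈ SYT μ n ∧ ∃ m, IsLeast (missingFirstColumn T) m ∧ Odd m}

theorem parityTableaux_finite (μ : YoungDiagram) (n : ℕ) : (parityTableaux μ n).Finite :=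
  (SSYT_finite μ n).subset fun _ hT => hT.1.1

/-- There are finitely many partitions of `k`. -/
theorem partitions_finite (k : ℕ) : {μ : YoungDiagram | μ.card = k}.Finite := by
  have hinj : Function.Injective YoungDiagram.cells := fun μ ν h => YoungDiagram.ext h
  refine Set.Finite.of_finite_image (f := YoungDiagram.cells)
    (((Finset.range k ×ˢ Finset.range k).powerset.finite_toSet).subset ?_) hinj.injOn
  rintro _ ⟨μ, hμ, rfl⟩
  simp only [Finset.coe_powerset, Set.mem_preimage, Set.mem_powerset_iff, Finset.coe_subset]
  rintro ⟨i, j⟩ hc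
  have hc' : (i, j) ∈ μ := (YoungDiagram.mem_cells _).1 hc
  have h1 : μ.rowLen i ≤ k := by
    rw [YoungDiagram.rowLen_eq_card, ← hμ]; exact Finset.card_filter_le _ _
  have h2 : μ.colLen j ≤ k := by
    rw [YoungDiagram.colLen_eq_card, ← hμ]; exact Finset.card_filter_le _ _
  have h3 := YoungDiagram.mem_iff_lt_rowLen.1 hc'
  have h4 := YoungDiagram.mem_iff_lt_colLen.1 hc'
  simp only [Finset.mem_product, Finset.mem_range]
  omega

/-- The finite set of all partitions `μ` with `|μ| = k`. -/
noncomputable def partitions (k : ℕ) : Finset YoungDiagram :=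
  (partitions_finite k).toFinset

end ChernPlethysm

/-! Write `p = x_1 + ⋯ + x_n`. Since `s_{(1^k)}` is the elementary symmetric polynomial `e_k`, the
left side is the coefficient of `t^k` in `∏ ((1 + p t) - x_i t) = ∑_j (-1)^j e_j t^j (1 + p t)^(n -
j)` (`prod_add_C_mul`).

Each summand, without its sign, counts tableaux (`sum_columnCount_mul_schurSum`): its
`t^k`-coefficient is `∑_μ c_j(μ) s_μ`, where `c_j(μ)` is the number of tableaux of shape `μ` with
distinct labels in `[n]` and `1, …, j` in the first column. Indeed `e_j` stands for the column
filled with `1, …, j`, and each of the `n - j` later labels is either unused (the term `1`) or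
placed in a new cell (the term `p t`), by the Pieri rule `sum_mul_schurSum`. The latter is proved by
induction on the number of variables, from the branching rule `schurSum_succ` and the local
bijection `card_addCell_filter_isStrip`.

A tableau with distinct labels whose first column misses `m` first is counted by `c_j` exactly for
`j < m`, so the alternating sum over `j` gives it weight `1` if `m` is odd and `0` otherwise
(`ncard_parityTableaux`). -/

namespace ChernPlethysm

open Finset

/-! ### Young diagrams and their row lengths -/

theorem mem_partitions {μ : YoungDiagram} {k : ℕ} : μ ∈ partitions k ↔ μ.card = k := by
  simp [partitions]

theorem mem_column {k i j : ℕ} : (i, j) ∈ column k ↔ i < k ∧ j = 0 := by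
  simp only [column, YoungDiagram.mem_ofRowLens, List.length_replicate, List.getElem_replicate,
    Nat.lt_one_iff, exists_prop]

theorem cells_column (k : ℕ) : (column k).cells = range k ×ˢ {0} := by
  ext ⟨i, j⟩
  simp [mem_column, eq_comm]

theorem card_column (k : ℕ) : (column k).card = k := by
  simp [YoungDiagram.card, cells_column]

theorem diagram_ext {μ ν : YoungDiagram} (h : ∀ i j, (i, j) ∈ μ ↔ (i, j) ∈ ν) : μ = ν := by
  ext ⟨i, j⟩
  simpa using h i j

theorem rowLen_ext {μ ν : YoungDiagram} (h : ∀ i, μ.rowLen i = ν.rowLen i) : μ = ν :=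
  diagram_ext fun i j => by simp [YoungDiagram.mem_iff_lt_rowLen, h]

theorem le_iff_mem {μ ν : YoungDiagram} : μ ≤ ν ↔ ∀ i j, (i, j) ∈ μ → (i, j) ∈ ν :=
  ⟨fun h _ _ hc => h hc, fun h c hc => h c.1 c.2 hc⟩

theorem card_le_card_of_le {μ ν : YoungDiagram} (h : μ ≤ ν) : μ.card ≤ ν.card :=
  Finset.card_le_card (YoungDiagram.cells_subset_iff.2 h)

theorem eq_of_le_of_card_le {μ ν : YoungDiagram} (h : μ ≤ ν) (hc : ν.card ≤ μ.card) : μ = ν :=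
  YoungDiagram.ext (Finset.eq_of_subset_of_card_le (YoungDiagram.cells_subset_iff.2 h) hc)

theorem exists_rowLen_eq_zero (μ : YoungDiagram) : ∃ m, μ.rowLen m = 0 := by
  obtain ⟨i, hi⟩ := YoungDiagram.exists_notMem_col μ 0
  rw [YoungDiagram.mem_cells, YoungDiagram.mem_iff_lt_rowLen] at hi
  exact ⟨i, by omega⟩

theorem exists_rowLen_eq {f : ℕ → ℕ} (hf : Antitone f) {m : ℕ} (hm : f m = 0) :
    ∃ μ : YoungDiagram, ∀ i, μ.rowLen i = f i := by
  refine ⟨⟨(range m ×ˢ range (f 0)).filter fun c => c.2 < f c.1, ?_⟩, fun i => ?_⟩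
  · rintro ⟨i, j⟩ ⟨i', j'⟩ ⟨h1, h2⟩ h
    simp only [coe_filter, mem_product, Finset.mem_range, Set.mem_ofPred_eq] at h h1 h2 ⊢
    have := hf h1
    omega
  · refine eq_of_forall_lt_iff fun j => ?_
    rw [← YoungDiagram.mem_iff_lt_rowLen, ← YoungDiagram.mem_cells]
    simp only [mem_filter, mem_product, Finset.mem_range]
    refine ⟨fun h => h.2, fun h => ⟨⟨?_, ?_⟩, h⟩⟩
    · by_contra hi
      have := hf (not_lt.1 hi)
      omega
    · exact lt_of_lt_of_le h (hf (Nat.zero_le i))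

/-- `κ` is obtained from `ν` by adding one cell. -/
def AddsCell (ν κ : YoungDiagram) : Prop := ν ≤ κ ∧ κ.card = ν.card + 1

/-- `λ / ν` is a horizontal strip. -/
def IsStrip (ν μ : YoungDiagram) : Prop := ν ≤ μ ∧ ∀ i j, (i + 1, j) ∈ μ → (i, j) ∈ ν

/-- The interlacing form of a horizontal strip; it turns the local rule into linear arithmetic on
row lengths. -/
theorem isStrip_iff_rowLen {ν μ : YoungDiagram} :
    IsStrip ν μ ↔ ∀ i, ν.rowLen i ≤ μ.rowLen i ∧ μ.rowLen (i + 1) ≤ ν.rowLen i := by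
  simp only [IsStrip, le_iff_mem, YoungDiagram.mem_iff_lt_rowLen, forall_and]
  refine and_congr (forall_congr' fun i => ?_) (forall_congr' fun i => ?_) <;>
    exact ⟨fun h => forall_lt_iff_le.1 h, fun h => forall_lt_iff_le.2 h⟩

theorem AddsCell.exists_cells {ν κ : YoungDiagram} (h : AddsCell ν κ) :
    ∃ c ∉ ν, κ.cells = insert c ν.cells := by
  have hs := YoungDiagram.cells_subset_iff.2 h.1
  have h1 : (κ.cells \ ν.cells).card = 1 := by
    have := card_sdiff_add_card_eq_card hs
    have h2 := h.2
    simp only [YoungDiagram.card] at h2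
    omega
  obtain ⟨c, hc⟩ := card_eq_one.1 h1
  refine ⟨c, ?_, ?_⟩
  · have : c ∈ κ.cells \ ν.cells := by simp [hc]
    simpa using (mem_sdiff.1 this).2
  · rw [← sdiff_union_of_subset hs, hc]
    rfl

theorem addsCell_iff_rowLen {ν κ : YoungDiagram} :
    AddsCell ν κ ↔ ∃ i, ∀ m, κ.rowLen m = ν.rowLen m + if m = i then 1 else 0 := by
  constructor
  · intro h
    obtain ⟨⟨a, b⟩, hc, hk⟩ := h.exists_cells
    have hrow : ∀ m, κ.row m = if m = a then insert (a, b) (ν.row m) else ν.row m := by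
      intro m
      ext d
      split_ifs with hm
      · simp only [mem_insert, YoungDiagram.mem_row_iff, ← YoungDiagram.mem_cells, hk]
        constructor
        · tauto
        · rintro (rfl | h)
          · exact ⟨Or.inl rfl, hm.symm⟩
          · tauto
      · simp only [YoungDiagram.mem_row_iff, ← YoungDiagram.mem_cells, hk, mem_insert]
        constructor
        · rintro ⟨rfl | h, h'⟩
          · exact absurd h'.symm hm
          · exact ⟨h, h'⟩
        · tauto
    refine ⟨a, fun m => ?_⟩
    rw [YoungDiagram.rowLen_eq_card, hrow, YoungDiagram.rowLen_eq_card]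
    split_ifs with hm
    · rw [card_insert_of_notMem]
      simpa [YoungDiagram.mem_row_iff] using fun h => absurd h hc
    · simp
  · rintro ⟨i, h⟩
    have hmem : ∀ a b, (a, b) ∈ κ ↔ (a, b) = (i, ν.rowLen i) ∨ (a, b) ∈ ν := by
      intro a b
      rw [YoungDiagram.mem_iff_lt_rowLen, YoungDiagram.mem_iff_lt_rowLen, h, Prod.mk.injEq]
      by_cases ha : a = i
      · subst ha
        simp only [if_true, true_and]
        omega
      · simp [ha]
    refine ⟨le_iff_mem.2 fun a b hab => (hmem a b).2 (Or.inr hab), ?_⟩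
    have hk : κ.cells = insert (i, ν.rowLen i) ν.cells := by
      ext ⟨a, b⟩
      simpa using hmem a b
    rw [YoungDiagram.card, hk, card_insert_of_notMem]
    simp [YoungDiagram.mem_iff_lt_rowLen]

theorem AddsCell.isStrip {ν κ : YoungDiagram} (h : AddsCell ν κ) : IsStrip ν κ := by
  obtain ⟨c, hc, hk⟩ := h.exists_cells
  refine ⟨h.1, fun i j hij => ?_⟩
  have h2 : (i, j) ∈ κ := κ.up_left_mem (Nat.le_succ i) le_rfl hij
  rw [← YoungDiagram.mem_cells, hk, mem_insert] at h2
  rcases h2 with h2 | h2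
  · subst h2
    rw [← YoungDiagram.mem_cells, hk, mem_insert] at hij
    rcases hij with h3 | h3
    · simp at h3
    · exact ν.up_left_mem (Nat.le_succ i) le_rfl h3
  · simpa using h2

theorem isStrip_refl (μ : YoungDiagram) : IsStrip μ μ :=
  ⟨le_rfl, fun i _ h => μ.up_left_mem (Nat.le_succ i) le_rfl h⟩

/-- All Young diagrams with at most `k` cells. -/
noncomputable def smallDiagrams (k : ℕ) : Finset YoungDiagram :=
  by classical exact (range (k + 1)).biUnion partitions

theorem mem_smallDiagrams {μ : YoungDiagram} {k : ℕ} : μ ∈ smallDiagrams k ↔ μ.card ≤ k := by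
  simp [smallDiagrams, mem_partitions]

open scoped Classical in
/-- The diagrams obtained from `μ` by removing a horizontal strip. -/
noncomputable def strips (μ : YoungDiagram) : Finset YoungDiagram :=
  (smallDiagrams μ.card).filter fun ν => IsStrip ν μ

theorem mem_strips {ν μ : YoungDiagram} : ν ∈ strips μ ↔ IsStrip ν μ := by
  simp only [strips, mem_filter, mem_smallDiagrams, and_iff_right_iff_imp]
  exact fun h => card_le_card_of_le h.1

open scoped Classical in
/-- The diagrams obtained from `μ` by adding one cell. -/
noncomputable def addCell (μ : YoungDiagram) : Finset YoungDiagram :=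
  (partitions (μ.card + 1)).filter fun κ => AddsCell μ κ

theorem mem_addCell {ν μ : YoungDiagram} : ν ∈ addCell μ ↔ AddsCell μ ν := by
  simp only [addCell, mem_filter, mem_partitions, and_iff_right_iff_imp]
  exact fun h => h.2

open scoped Classical in
/-- The diagrams obtained from `μ` by removing one cell. -/
noncomputable def removeCell (μ : YoungDiagram) : Finset YoungDiagram :=
  (smallDiagrams μ.card).filter fun κ => AddsCell κ μ

theorem mem_removeCell {ν μ : YoungDiagram} : ν ∈ removeCell μ ↔ AddsCell ν μ := by
  simp only [removeCell, mem_filter, mem_smallDiagrams, and_iff_right_iff_imp]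
  exact fun h => card_le_card_of_le h.1

theorem notMem_removeCell_self (μ : YoungDiagram) : μ ∉ removeCell μ := fun h => by
  have := (mem_removeCell.1 h).2
  omega

/-- Two finite sets have the same cardinality if a relation matches their elements uniquely. -/
theorem card_eq_of_forall_existsUnique {α β : Type*} {s : Finset α} {t : Finset β}
    (r : α → β → Prop) (h₁ : ∀ a ∈ s, ∃ b ∈ t, r a b) (h₂ : ∀ b ∈ t, ∃ a ∈ s, r a b)
    (u₁ : ∀ a ∈ s, ∀ a' ∈ s, ∀ b ∈ t, r a b → r a' b → a = a')
    (u₂ : ∀ a ∈ s, ∀ b ∈ t, ∀ b' ∈ t, r a b → r a b' → b = b') : s.card = t.card :=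
  le_antisymm
    (card_le_card_of_forall_subsingleton r h₁
      fun b hb a ha a' ha' => u₁ a ha.1 a' ha'.1 b hb ha.2 ha'.2)
    (card_le_card_of_forall_subsingleton' r h₂
      fun a ha b hb b' hb' => u₂ a ha b hb.1 b' hb'.1 hb.2 hb'.2)

theorem exists_rowLen_add {μ : YoungDiagram} {f : ℕ → ℕ} (hf : ∀ m, f (m + 1) ≤ f m) {i : ℕ}
    (h : ∀ m, f m = μ.rowLen m + if m = i then 1 else 0) :
    ∃ κ : YoungDiagram, (∀ m, κ.rowLen m = f m) ∧ AddsCell μ κ := by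
  obtain ⟨m, hm⟩ := exists_rowLen_eq_zero μ
  -- This row lies below both the last row of `μ` and the row `i` of the new cell.
  have h0 : f (m + i + 1) = 0 := by
    have := μ.rowLen_anti m (m + i + 1) (by omega)
    rw [h, if_neg (by omega)]
    omega
  obtain ⟨κ, hκ⟩ := exists_rowLen_eq (antitone_nat_of_succ_le hf) h0
  exact ⟨κ, hκ, addsCell_iff_rowLen.2 ⟨i, fun m => by rw [hκ, h]⟩⟩

theorem exists_rowLen_sub {μ : YoungDiagram} {f : ℕ → ℕ} (hf : ∀ m, f (m + 1) ≤ f m) {i : ℕ}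
    (h : ∀ m, μ.rowLen m = f m + if m = i then 1 else 0) :
    ∃ κ : YoungDiagram, (∀ m, κ.rowLen m = f m) ∧ AddsCell κ μ := by
  obtain ⟨m, hm⟩ := exists_rowLen_eq_zero μ
  obtain ⟨κ, hκ⟩ := exists_rowLen_eq (antitone_nat_of_succ_le hf) (m := m) (by have := h m; omega)
  exact ⟨κ, hκ, addsCell_iff_rowLen.2 ⟨i, fun m => by rw [hκ, h]⟩⟩

open scoped Classical in
/-- The local rule for adding a cell to the outer shape and removing a horizontal strip. -/
theorem card_addCell_filter_isStrip (κ μ : YoungDiagram) :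
    ((addCell μ).filter fun ρ => IsStrip κ ρ).card =
      ((removeCell κ).filter fun ν => IsStrip ν μ).card + if IsStrip κ μ then 1 else 0 := by
  split_ifs with hs
  · have hn : κ ∉ (removeCell κ).filter fun ν => IsStrip ν μ :=
      fun h => notMem_removeCell_self κ (mem_filter.1 h).1
    rw [← card_insert_of_notMem hn]
    rw [isStrip_iff_rowLen] at hs
    -- A cell added to `μ` in row `i + 1` is matched with a cell removed from `κ` in row `i`. A cell
    -- added in row `0`, always possible here, is matched with `κ` itself: this is the extra `1`.
    refine card_eq_of_forall_existsUnique
      (fun ρ ν => ∀ i, ρ.rowLen (i + 1) + ν.rowLen i = μ.rowLen (i + 1) + κ.rowLen i)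
      ?_ ?_ ?_ ?_
    · intro ρ hρ
      rw [mem_filter, mem_addCell, addsCell_iff_rowLen, isStrip_iff_rowLen] at hρ
      obtain ⟨⟨i, hi⟩, h⟩ := hρ
      rcases i with _ | i
      · exact ⟨κ, mem_insert_self _ _, fun m => by rw [hi, if_neg (by omega), add_zero]⟩
      · obtain ⟨ν, hν, hc⟩ := exists_rowLen_sub (μ := κ) (i := i)
          (f := fun m => κ.rowLen m - if m = i then 1 else 0)
          (fun m => by
            have := hi (m + 1); have := h m; have := hs (m + 1); have := hs m
            split_ifs at * <;> omega)
          (fun m => by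
            have := hi (m + 1); have := h m
            split_ifs at * <;> omega)
        refine ⟨ν, mem_insert_of_mem (mem_filter.2 ⟨mem_removeCell.2 hc, ?_⟩), fun m => ?_⟩
        · rw [isStrip_iff_rowLen]
          intro m
          have := hi (m + 1); have := h m; have := hs m; have := hν m
          split_ifs at * <;> omega
        · have := hi (m + 1); have := h m; have := hs m; have := hν m
          split_ifs at * <;> omega
    · intro ν hν
      rw [mem_insert, mem_filter, mem_removeCell, addsCell_iff_rowLen, isStrip_iff_rowLen] at hν
      rcases hν with rfl | ⟨⟨i, hi⟩, h⟩
      · obtain ⟨ρ, hρ, hc⟩ := exists_rowLen_add (μ := μ) (i := 0)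
          (f := fun m => μ.rowLen m + if m = 0 then 1 else 0)
          (fun m => by
            have := hs m
            split_ifs at * <;> omega)
          (fun m => rfl)
        refine ⟨ρ, mem_filter.2 ⟨mem_addCell.2 hc, ?_⟩, fun m => ?_⟩
        · rw [isStrip_iff_rowLen]
          intro m
          have := hs m; have := hρ m; have := hρ (m + 1)
          split_ifs at * <;> omega
        · have := hρ (m + 1)
          split_ifs at * <;> omega
      · obtain ⟨ρ, hρ, hc⟩ := exists_rowLen_add (μ := μ) (i := i + 1)
          (f := fun m => μ.rowLen m + if m = i + 1 then 1 else 0)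
          (fun m => by
            have := hs m; have := h m; have := hi m
            split_ifs at * <;> omega)
          (fun m => rfl)
        refine ⟨ρ, mem_filter.2 ⟨mem_addCell.2 hc, ?_⟩, fun m => ?_⟩
        · rw [isStrip_iff_rowLen]
          intro m
          have := hs m; have := h m; have := hi m; have := hρ m; have := hρ (m + 1)
          split_ifs at * <;> omega
        · have := hρ (m + 1); have := hi m
          split_ifs at * <;> omega
    · intro ρ hρ ρ' hρ' ν _ h h'
      rw [mem_filter, mem_addCell, addsCell_iff_rowLen] at hρ hρ'
      obtain ⟨⟨i, hi⟩, -⟩ := hρ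
      obtain ⟨⟨i', hi'⟩, -⟩ := hρ'
      -- The relation does not see row `0` of `ρ`, so the row of the added cell is compared instead.
      have hii : i = i' := by
        rcases i with _ | i
        · rcases i' with _ | i'
          · rfl
          · have := hi (i' + 1); have := hi' (i' + 1); have := h i'; have := h' i'
            split_ifs at * <;> omega
        · have := hi (i + 1); have := hi' (i + 1); have := h i; have := h' i
          split_ifs at * <;> omega
      subst hii
      exact rowLen_ext fun m => by rw [hi, hi']
    · intro ρ _ ν _ ν' _ h h'
      exact rowLen_ext fun m => by have := h m; have := h' m; omega
  · rw [add_zero]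
    rw [isStrip_iff_rowLen] at hs
    push Not at hs
    obtain ⟨a, ha⟩ := hs
    -- Interlacing fails at row `a`, and a single cell can repair it only if `κ` exceeds `μ` there
    -- by exactly one. So the cell added to `μ` and the cell removed from `κ` both lie in row `a`.
    refine card_eq_of_forall_existsUnique
      (fun ρ ν => ∀ i, ρ.rowLen i + ν.rowLen i = μ.rowLen i + κ.rowLen i)
      ?_ ?_ ?_ ?_
    · intro ρ hρ
      rw [mem_filter, mem_addCell, addsCell_iff_rowLen, isStrip_iff_rowLen] at hρ
      obtain ⟨⟨i, hi⟩, h⟩ := hρ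
      have hai : a = i ∧ κ.rowLen i = μ.rowLen i + 1 := by
        by_cases hai : a = i
        · subst hai
          have := h a; have := hi a; have := hi (a + 1)
          split_ifs at * <;> omega
        · have := h a; have := hi a; have := hi (a + 1)
          split_ifs at * <;> omega
      obtain ⟨ν, hν, hc⟩ := exists_rowLen_sub (μ := κ) (i := i)
        (f := fun m => κ.rowLen m - if m = i then 1 else 0)
        (fun m => by
          have := hi (m + 1); have := h (m + 1); have := h m; have := hi m
          have := μ.rowLen_anti m (m + 1) (by omega)
          by_cases hm : m = i
          · subst hm
            split_ifs at * <;> omega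
          · split_ifs at * <;> omega)
        (fun m => by
          by_cases hm : m = i
          · subst hm
            simp only [if_true]; omega
          · simp [hm])
      refine ⟨ν, mem_filter.2 ⟨mem_removeCell.2 hc, ?_⟩, fun m => ?_⟩
      · rw [isStrip_iff_rowLen]
        intro m
        have := μ.rowLen_anti m (m + 1) (by omega)
        have := hi (m + 1); have := hi m; have := h m; have := hν m
        by_cases hm : m = i
        · subst hm
          split_ifs at * <;> omega
        · split_ifs at * <;> omega
      · have := hi m; have := h m; have := hν m
        by_cases hm : m = i
        · subst hm
          split_ifs at * <;> omega
        · split_ifs at * <;> omega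
    · intro ν hν
      rw [mem_filter, mem_removeCell, addsCell_iff_rowLen, isStrip_iff_rowLen] at hν
      obtain ⟨⟨i, hi⟩, h⟩ := hν
      have hai : a = i ∧ κ.rowLen i = μ.rowLen i + 1 := by
        by_cases hai : a = i
        · subst hai
          have := h a; have := hi a
          split_ifs at * <;> omega
        · have := h a; have := hi a
          split_ifs at * <;> omega
      obtain ⟨ρ, hρ, hc⟩ := exists_rowLen_add (μ := μ) (i := i)
        (f := fun m => μ.rowLen m + if m = i then 1 else 0)
        (fun m => by
          have := hi (m + 1); have := h m; have := hi m
          have := μ.rowLen_anti m (m + 1) (by omega)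
          have := κ.rowLen_anti m (m + 1) (by omega)
          by_cases hm : m + 1 = i
          · subst hm
            split_ifs at * <;> omega
          · split_ifs at * <;> omega)
        (fun m => rfl)
      refine ⟨ρ, mem_filter.2 ⟨mem_addCell.2 hc, ?_⟩, fun m => ?_⟩
      · rw [isStrip_iff_rowLen]
        intro m
        have := κ.rowLen_anti m (m + 1) (by omega)
        have := hi m; have := h m; have := hρ m; have := hρ (m + 1)
        by_cases hm : m + 1 = i
        · subst hm
          split_ifs at * <;> omega
        · by_cases hm' : m = i
          · subst hm'
            split_ifs at * <;> omega
          · split_ifs at * <;> omega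
      · have := hi m; have := hρ m
        split_ifs at * <;> omega
    · intro ρ _ ρ' _ ν _ h h'
      exact rowLen_ext fun m => by have := h m; have := h' m; omega
    · intro ρ _ ν _ ν' _ h h'
      exact rowLen_ext fun m => by have := h m; have := h' m; omega

/-! ### Fillings and Schur sums -/

open scoped Classical in
/-- The tableaux in `SSYT(μ, n)`, as functions of the position. -/
noncomputable def fillings (μ : YoungDiagram) (n : ℕ) : Finset (ℕ → ℕ → ℕ) :=
  (SSYT_finite μ n).toFinset.image fun T : SemistandardYoungTableau μ => ⇑T

open scoped Classical in
theorem sum_fillings {R : Type*} [AddCommMonoid R] (μ : YoungDiagram) (n : ℕ)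
    (φ : (ℕ → ℕ → ℕ) → R) :
    ∑ f ∈ fillings μ n, φ f = ∑ T ∈ (SSYT_finite μ n).toFinset, φ T :=
  sum_image fun _ _ _ _ h => DFunLike.coe_injective h

theorem mem_fillings {μ : YoungDiagram} {n : ℕ} {f : ℕ → ℕ → ℕ} :
    f ∈ fillings μ n ↔ (∀ i j₁ j₂, j₁ < j₂ → (i, j₂) ∈ μ → f i j₁ ≤ f i j₂) ∧
      (∀ i₁ i₂ j, i₁ < i₂ → (i₂, j) ∈ μ → f i₁ j < f i₂ j) ∧
      (∀ i j, (i, j) ∉ μ → f i j = 0) ∧ ∀ i j, (i, j) ∈ μ → 1 ≤ f i j ∧ f i j ≤ n := by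
  simp only [fillings, mem_image, Set.Finite.mem_toFinset]
  constructor
  · rintro ⟨T, hT, rfl⟩
    exact ⟨fun i j₁ j₂ => T.row_weak, fun i₁ i₂ j => T.col_strict, fun i j => T.zeros, hT⟩
  · rintro ⟨h1, h2, h3, h4⟩
    exact ⟨⟨f, fun {i j₁ j₂} => h1 i j₁ j₂, fun {i₁ i₂ j} => h2 i₁ i₂ j, fun {i j} => h3 i j⟩,
      h4, rfl⟩

/-- The filling of `μ` that agrees with `g` on `ν` and has the label `n + 1` elsewhere. -/
def extendFilling (ν μ : YoungDiagram) (n : ℕ) (g : ℕ → ℕ → ℕ) : ℕ → ℕ → ℕ := fun i j =>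
  if (i, j) ∈ ν then g i j else if (i, j) ∈ μ then n + 1 else 0

theorem extendFilling_mem {ν μ : YoungDiagram} {n : ℕ} {g : ℕ → ℕ → ℕ} (h : IsStrip ν μ)
    (hg : g ∈ fillings ν n) : extendFilling ν μ n g ∈ fillings μ (n + 1) := by
  obtain ⟨h1, h2, -, h4⟩ := mem_fillings.1 hg
  have hle := le_iff_mem.1 h.1
  refine mem_fillings.2 ⟨fun i j₁ j₂ hj hm => ?_, fun i₁ i₂ j hi hm => ?_, fun i j hm => ?_,
    fun i j hm => ?_⟩
  · have hm' := μ.up_left_mem le_rfl hj.le hm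
    by_cases hν : (i, j₂) ∈ ν
    · have hν' := ν.up_left_mem le_rfl hj.le hν
      simpa [extendFilling, hν, hν'] using h1 i j₁ j₂ hj hν
    · by_cases hν' : (i, j₁) ∈ ν
      · have := h4 i j₁ hν'
        simp only [extendFilling, hν, hν', hm, if_true, if_false]
        omega
      · simp [extendFilling, hν, hν', hm, hm']
  · have hν' : (i₁, j) ∈ ν := h.2 i₁ j (μ.up_left_mem hi le_rfl hm)
    by_cases hν : (i₂, j) ∈ ν
    · simpa [extendFilling, hν, hν'] using h2 i₁ i₂ j hi hν
    · have := h4 i₁ j hν'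
      simp only [extendFilling, hν, hν', hm, if_true, if_false]
      omega
  · have hν : (i, j) ∉ ν := fun h => hm (hle i j h)
    simp [extendFilling, hm, hν]
  · by_cases hν : (i, j) ∈ ν
    · have := h4 i j hν
      simp only [extendFilling, hν, if_true]
      omega
    · simp [extendFilling, hν, hm]

theorem extendFilling_le_iff {ν μ : YoungDiagram} {n : ℕ} {g : ℕ → ℕ → ℕ}
    (hg : g ∈ fillings ν n) {i j : ℕ} (hm : (i, j) ∈ μ) :
    extendFilling ν μ n g i j ≤ n ↔ (i, j) ∈ ν := by
  by_cases hν : (i, j) ∈ ν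
  · simpa [extendFilling, hν] using ((mem_fillings.1 hg).2.2.2 i j hν).2
  · simp [extendFilling, hν, hm]

/-- The cells with labels at most `n` form a diagram by monotonicity, and strict columns allow at
most one `n + 1` per column, so the rest is a horizontal strip. -/
theorem exists_extendFilling_eq {μ : YoungDiagram} {n : ℕ} {f : ℕ → ℕ → ℕ}
    (hf : f ∈ fillings μ (n + 1)) :
    ∃ ν g, IsStrip ν μ ∧ g ∈ fillings ν n ∧ extendFilling ν μ n g = f := by
  obtain ⟨h1, h2, h3, h4⟩ := mem_fillings.1 hf
  have hν : ∃ ν : YoungDiagram, ∀ i j, (i, j) ∈ ν ↔ (i, j) ∈ μ ∧ f i j ≤ n := by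
    refine ⟨⟨μ.cells.filter fun c => f c.1 c.2 ≤ n, ?_⟩, fun i j => ?_⟩
    · rintro ⟨i, j⟩ ⟨i', j'⟩ ⟨hi, hj⟩ h
      simp only [coe_filter, YoungDiagram.mem_cells, Set.mem_ofPred_eq] at hi hj h ⊢
      refine ⟨μ.up_left_mem hi hj h.1, ?_⟩
      have ha : f i' j' ≤ f i' j := by
        rcases hj.lt_or_eq with hj | rfl
        · exact h1 _ _ _ hj (μ.up_left_mem hi le_rfl h.1)
        · exact le_rfl
      have hb : f i' j ≤ f i j := by
        rcases hi.lt_or_eq with hi | rfl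
        · exact (h2 _ _ _ hi h.1).le
        · exact le_rfl
      exact (ha.trans hb).trans h.2
    · rw [← YoungDiagram.mem_cells]
      simp
  obtain ⟨ν, hν⟩ := hν
  refine ⟨ν, fun i j => if (i, j) ∈ ν then f i j else 0,
    ⟨le_iff_mem.2 fun i j h => ((hν i j).1 h).1, fun i j h => (hν i j).2 ⟨?_, ?_⟩⟩,
    mem_fillings.2 ⟨fun i j₁ j₂ hj hm => ?_, fun i₁ i₂ j hi hm => ?_, fun i j hm => ?_,
      fun i j hm => ?_⟩, ?_⟩
  · exact μ.up_left_mem (Nat.le_succ i) le_rfl h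
  · have := h2 i (i + 1) j (Nat.lt_succ_self i) h
    have := h4 (i + 1) j h
    omega
  · simpa [hm, ν.up_left_mem le_rfl hj.le hm] using h1 i j₁ j₂ hj ((hν _ _).1 hm).1
  · simpa [hm, ν.up_left_mem hi.le le_rfl hm] using h2 i₁ i₂ j hi ((hν _ _).1 hm).1
  · simp [hm]
  · simpa [hm] using ⟨(h4 i j ((hν _ _).1 hm).1).1, ((hν _ _).1 hm).2⟩
  · funext i j
    by_cases hm : (i, j) ∈ μ
    · by_cases hn : (i, j) ∈ ν
      · simp [extendFilling, hn]
      · have := h4 i j hm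
        have : ¬ f i j ≤ n := fun h => hn ((hν i j).2 ⟨hm, h⟩)
        simp only [extendFilling, hn, hm, if_true, if_false]
        omega
    · have hn : (i, j) ∉ ν := fun h => hm ((hν i j).1 h).1
      simp [extendFilling, hn, hm, h3 i j hm]

/-- Summation over fillings, by the position of the labels `n + 1`. -/
theorem sum_fillings_succ {R : Type*} [AddCommMonoid R] (μ : YoungDiagram) (n : ℕ)
    (φ : (ℕ → ℕ → ℕ) → R) :
    ∑ f ∈ fillings μ (n + 1), φ f =
      ∑ ν ∈ strips μ, ∑ g ∈ fillings ν n, φ (extendFilling ν μ n g) := by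
  rw [sum_sigma']
  symm
  refine sum_bij (fun p _ => extendFilling p.1 μ n p.2) ?_ ?_ ?_ fun _ _ => rfl
  · rintro ⟨ν, g⟩ h
    rw [mem_sigma, mem_strips] at h
    exact extendFilling_mem h.1 h.2
  · rintro ⟨ν, g⟩ h ⟨ν', g'⟩ h' he
    rw [mem_sigma, mem_strips] at h h'
    obtain ⟨hs, hg⟩ := h
    obtain ⟨hs', hg'⟩ := h'
    dsimp only at hs hs' hg hg' he
    have hνν : ν = ν' := by
      refine diagram_ext fun i j => ?_
      by_cases hm : (i, j) ∈ μ
      · rw [← extendFilling_le_iff hg hm, he, extendFilling_le_iff hg' hm]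
      · exact iff_of_false (fun hh => hm (hs.1 hh)) fun hh => hm (hs'.1 hh)
    subst hνν
    have : g = g' := by
      funext i j
      by_cases hm : (i, j) ∈ ν
      · simpa [extendFilling, hm] using congrFun (congrFun he i) j
      · rw [(mem_fillings.1 hg).2.2.1 i j hm, (mem_fillings.1 hg').2.2.1 i j hm]
    rw [this]
  · intro f hf
    obtain ⟨ν, g, hs, hg, rfl⟩ := exists_extendFilling_eq hf
    exact ⟨⟨ν, g⟩, mem_sigma.2 ⟨mem_strips.2 hs, hg⟩, rfl⟩

theorem fillings_zero_of_ne_bot {μ : YoungDiagram} (h : μ ≠ ⊥) : fillings μ 0 = ∅ := by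
  refine eq_empty_of_forall_notMem fun f hf => h (diagram_ext fun i j => ?_)
  refine iff_of_false (fun hm => ?_) (YoungDiagram.notMem_bot _)
  have := (mem_fillings.1 hf).2.2.2 i j hm
  omega

theorem fillings_bot (n : ℕ) : fillings ⊥ n = {fun _ _ => 0} := by
  ext f
  rw [mem_singleton, mem_fillings]
  constructor
  · rintro ⟨-, -, h, -⟩
    funext i j
    exact h i j (YoungDiagram.notMem_bot _)
  · rintro rfl
    simp [YoungDiagram.notMem_bot]

/-! ### Branching rule and Pieri rule -/

section Schur

variable {R : Type*} [CommRing R]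

/-- The Schur polynomial of `μ` evaluated at `x 1, …, x n`. -/
noncomputable def schurSum (x : ℕ → R) (μ : YoungDiagram) (n : ℕ) : R :=
  ∑ f ∈ fillings μ n, ∏ c ∈ μ.cells, x (f c.1 c.2)

theorem schurSum_zero_of_ne_bot (x : ℕ → R) {μ : YoungDiagram} (h : μ ≠ ⊥) :
    schurSum x μ 0 = 0 := by
  rw [schurSum, fillings_zero_of_ne_bot h, sum_empty]

theorem schurSum_bot (x : ℕ → R) (n : ℕ) : schurSum x ⊥ n = 1 := by
  rw [schurSum, fillings_bot]
  simp

theorem schurSum_succ (x : ℕ → R) (μ : YoungDiagram) (n : ℕ) :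
    schurSum x μ (n + 1) =
      ∑ ν ∈ strips μ, x (n + 1) ^ (μ.card - ν.card) * schurSum x ν n := by
  rw [schurSum, sum_fillings_succ]
  refine sum_congr rfl fun ν hν => ?_
  have hs := YoungDiagram.cells_subset_iff.2 (mem_strips.1 hν).1
  rw [schurSum, mul_sum]
  refine sum_congr rfl fun g hg => ?_
  rw [← prod_sdiff hs]
  congr 1
  · rw [YoungDiagram.card, YoungDiagram.card, ← card_sdiff_of_subset hs, ← prod_const]
    refine prod_congr rfl fun c hc => ?_
    rw [mem_sdiff, YoungDiagram.mem_cells, YoungDiagram.mem_cells] at hc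
    simp [extendFilling, hc.1, hc.2]
  · refine prod_congr rfl fun c hc => ?_
    rw [YoungDiagram.mem_cells] at hc
    simp [extendFilling, hc]

/-- The Pieri rule for adding a single cell. -/
theorem sum_mul_schurSum (x : ℕ → R) (n : ℕ) : ∀ μ : YoungDiagram,
    (∑ i ∈ range n, x (i + 1)) * schurSum x μ n = ∑ ρ ∈ addCell μ, schurSum x ρ n := by
  classical
  induction n with
  | zero =>
    intro μ
    rw [range_zero, sum_empty, zero_mul]
    symm
    refine sum_eq_zero fun ρ hρ => schurSum_zero_of_ne_bot x ?_
    rintro rfl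
    have := (mem_addCell.1 hρ).2
    simp [YoungDiagram.card] at this
  | succ n ih =>
    intro μ
    set y := x (n + 1)
    -- Both sides are expanded in these terms over the inner shape `κ`; comparing coefficients
    -- leaves exactly the local rule.
    let w : YoungDiagram → R := fun κ => y ^ (μ.card + 1 - κ.card) * schurSum x κ n
    let U := smallDiagrams (μ.card + 1)
    have hsub : ∀ ν ∈ strips μ, ν.card ≤ μ.card := fun ν h =>
      card_le_card_of_le (mem_strips.1 h).1
    have e1 : (∑ i ∈ range n, x (i + 1)) * schurSum x μ (n + 1) =
        ∑ κ ∈ U, (((removeCell κ).filter fun ν => IsStrip ν μ).card : R) * w κ := by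
      have : (∑ i ∈ range n, x (i + 1)) * schurSum x μ (n + 1) =
          ∑ ν ∈ strips μ, ∑ κ ∈ addCell ν, w κ := by
        rw [schurSum_succ, mul_sum]
        refine sum_congr rfl fun ν hν => ?_
        rw [mul_left_comm, ih, mul_sum]
        refine sum_congr rfl fun κ hκ => ?_
        have h1 := (mem_addCell.1 hκ).2
        have h2 := hsub ν hν
        simp only [w]
        congr 2
        omega
      rw [this, sum_comm' (t' := U) (s' := fun κ => (removeCell κ).filter fun ν => IsStrip ν μ)]
      · simp
      · intro ν κ
        simp only [mem_strips, mem_addCell, mem_filter, mem_removeCell, U, mem_smallDiagrams]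
        constructor
        · rintro ⟨h, h'⟩
          have := card_le_card_of_le h.1
          have := h'.2
          exact ⟨⟨h', h⟩, by omega⟩
        · tauto
    have e2 : y * schurSum x μ (n + 1) = ∑ κ ∈ U, (if IsStrip κ μ then 1 else 0) * w κ := by
      simp only [ite_mul, one_mul, zero_mul]
      rw [← sum_filter]
      have : U.filter (fun κ => IsStrip κ μ) = strips μ := by
        ext κ
        simp only [U, mem_filter, mem_smallDiagrams, mem_strips, and_iff_right_iff_imp]
        intro h
        have := card_le_card_of_le h.1
        omega
      rw [this, schurSum_succ, mul_sum]
      refine sum_congr rfl fun κ hκ => ?_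
      have := hsub κ hκ
      simp only [w]
      rw [Nat.sub_add_comm this, pow_succ']
      ring
    have e3 : ∑ ρ ∈ addCell μ, schurSum x ρ (n + 1) =
        ∑ κ ∈ U, (((addCell μ).filter fun ρ => IsStrip κ ρ).card : R) * w κ := by
      have : ∑ ρ ∈ addCell μ, schurSum x ρ (n + 1) = ∑ ρ ∈ addCell μ, ∑ κ ∈ strips ρ, w κ := by
        refine sum_congr rfl fun ρ hρ => ?_
        rw [schurSum_succ, (mem_addCell.1 hρ).2]
      rw [this, sum_comm' (t' := U) (s' := fun κ => (addCell μ).filter fun ρ => IsStrip κ ρ)]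
      · simp
      · intro ρ κ
        simp only [mem_strips, mem_addCell, mem_filter, U, mem_smallDiagrams]
        constructor
        · rintro ⟨h, h'⟩
          have := card_le_card_of_le h'.1
          have := h.2
          exact ⟨⟨h, h'⟩, by omega⟩
        · tauto
    rw [sum_range_succ, add_mul, e1, e2, e3, ← sum_add_distrib]
    refine sum_congr rfl fun κ _ => ?_
    rw [card_addCell_filter_isStrip, ← add_mul]
    push_cast
    rfl

end Schur

/-! ### One-column shapes -/

theorem column_zero : column 0 = ⊥ :=
  diagram_ext fun i j => by simp [mem_column, YoungDiagram.notMem_bot]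

theorem addsCell_column (k : ℕ) : AddsCell (column k) (column (k + 1)) :=
  ⟨le_iff_mem.2 fun i j h => by rw [mem_column] at h ⊢; omega, by rw [card_column, card_column]⟩

theorem strips_column_succ [DecidableEq YoungDiagram] (k : ℕ) :
    strips (column (k + 1)) = {column (k + 1), column k} := by
  ext ν
  rw [mem_strips, mem_insert, mem_singleton]
  constructor
  · intro h
    have hle : column k ≤ ν := le_iff_mem.2 fun i j hc => h.2 i j <| by
      rw [mem_column] at hc ⊢
      omega
    have h1 := card_column k
    have h2 := card_column (k + 1)
    by_cases hc : k + 1 ≤ ν.card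
    · exact Or.inl (eq_of_le_of_card_le h.1 (by omega))
    · exact Or.inr (eq_of_le_of_card_le hle (by omega)).symm
  · rintro (rfl | rfl)
    · exact isStrip_refl _
    · exact (addsCell_column k).isStrip

/-! ### Elementary symmetric polynomials as coefficients -/

section Coefficients

variable {R : Type*} [CommRing R]

theorem coeff_mul_one_add_C_mul_X_zero (q : Polynomial R) (a : R) :
    (q * (1 + Polynomial.C a * Polynomial.X)).coeff 0 = q.coeff 0 := by
  simp [Polynomial.mul_coeff_zero]

theorem coeff_mul_one_add_C_mul_X_succ (q : Polynomial R) (a : R) (k : ℕ) :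
    (q * (1 + Polynomial.C a * Polynomial.X)).coeff (k + 1) =
      q.coeff (k + 1) + a * q.coeff k := by
  rw [mul_add, mul_one, mul_left_comm, Polynomial.coeff_add, Polynomial.coeff_C_mul,
    Polynomial.coeff_mul_X]

/-- The generating polynomial of the elementary symmetric functions of `x 1, …, x n`. -/
noncomputable def elemGen (x : ℕ → R) (n : ℕ) : Polynomial R :=
  ∏ i ∈ range n, (1 + Polynomial.C (x (i + 1)) * Polynomial.X)

theorem elemGen_succ (x : ℕ → R) (n : ℕ) :
    elemGen x (n + 1) =
      elemGen x n * (1 + Polynomial.C (x (n + 1)) * Polynomial.X) := by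
  rw [elemGen, prod_range_succ, elemGen]

theorem coeff_elemGen_of_lt (x : ℕ → R) (n : ℕ) : ∀ k, n < k → (elemGen x n).coeff k = 0 := by
  induction n with
  | zero =>
    intro k hk
    simp [elemGen, Polynomial.coeff_one, hk.ne']
  | succ n ih =>
    rintro (_ | k) hk
    · omega
    · rw [elemGen_succ, coeff_mul_one_add_C_mul_X_succ, ih _ (by omega), ih _ (by omega), mul_zero,
        add_zero]

/-- A horizontal strip in a column has at most one cell, so branching becomes the recursion for
elementary symmetric polynomials. -/
theorem schurSum_column (x : ℕ → R) (n : ℕ) : ∀ k,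
    schurSum x (column k) n = (elemGen x n).coeff k := by
  classical
  induction n with
  | zero =>
    rintro (_ | k)
    · simp [column_zero, schurSum_bot, elemGen]
    · rw [schurSum_zero_of_ne_bot]
      · simp [elemGen, Polynomial.coeff_one]
      · intro h
        have := card_column (k + 1)
        simp [h, YoungDiagram.card] at this
  | succ n ih =>
    rintro (_ | k)
    · rw [elemGen_succ, coeff_mul_one_add_C_mul_X_zero, ← ih, column_zero, schurSum_bot,
        schurSum_bot]
    · have hne : column (k + 1) ≠ column k := fun h => by
        have h1 := card_column (k + 1)
        rw [h, card_column] at h1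
        omega
      rw [schurSum_succ, strips_column_succ, sum_pair hne, elemGen_succ,
        coeff_mul_one_add_C_mul_X_succ, ih, ih, card_column, card_column]
      simp

/-- The homogenised form of the factorisation of `elemGen`. -/
theorem prod_add_C_mul (x : ℕ → R) (n : ℕ) (a b : Polynomial R) :
    ∏ i ∈ range n, (a + Polynomial.C (x (i + 1)) * b) =
      ∑ j ∈ range (n + 1), Polynomial.C ((elemGen x n).coeff j) * b ^ j * a ^ (n - j) := by
  induction n with
  | zero => simp [elemGen]
  | succ n ih =>
    rw [prod_range_succ, ih, sum_range_succ' _ (n + 1), elemGen_succ, coeff_mul_one_add_C_mul_X_zero,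
      mul_add]
    simp only [coeff_mul_one_add_C_mul_X_succ, Polynomial.C_add, add_mul, sum_add_distrib]
    rw [add_right_comm]
    refine congrArg₂ (· + ·) ?_ ?_
    -- The right side has one term more, whose coefficient of index `n + 1` vanishes.
    · rw [sum_mul, sum_range_succ', sum_range_succ, coeff_elemGen_of_lt x n (n + 1) (by omega)]
      simp only [Polynomial.C_0, zero_mul, add_zero]
      refine congrArg₂ (· + ·) ?_ ?_
      · refine sum_congr rfl fun j hj => ?_
        rw [mem_range] at hj
        rw [show n + 1 - (j + 1) = (n - (j + 1)) + 1 by omega, pow_succ]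
        ring
      · simp only [pow_zero, mul_one, Nat.sub_zero, pow_succ]
        ring
    · rw [sum_mul]
      refine sum_congr rfl fun j hj => ?_
      rw [Nat.succ_sub_succ, Polynomial.C_mul]
      ring

end Coefficients

/-! ### Injective fillings with prescribed small labels in the first column -/

/-- The labels of `f` on `μ` are distinct, and `1, …, j` all occur in the first column. -/
def HasInitialColumn (j : ℕ) (μ : YoungDiagram) (f : ℕ → ℕ → ℕ) : Prop :=
  (∀ c ∈ μ, ∀ d ∈ μ, f c.1 c.2 = f d.1 d.2 → c = d) ∧
    ∀ v, 1 ≤ v → v ≤ j → ∃ i, (i, 0) ∈ μ ∧ f i 0 = v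

open scoped Classical in
/-- The number of fillings of `μ` with distinct labels in `[n]` whose first column contains
`1, …, j`. -/
noncomputable def columnCount (μ : YoungDiagram) (n j : ℕ) : ℕ :=
  ∑ f ∈ fillings μ n, if HasInitialColumn j μ f then 1 else 0

/-- All new cells share the label `n + 1`, which `g` does not use on `ν`, so distinctness allows at
most one of them. -/
theorem injective_extendFilling_iff {ν μ : YoungDiagram} {n : ℕ} {g : ℕ → ℕ → ℕ} (h : ν ≤ μ)
    (hg : g ∈ fillings ν n) :
    (∀ c ∈ μ, ∀ d ∈ μ,
      extendFilling ν μ n g c.1 c.2 = extendFilling ν μ n g d.1 d.2 → c = d) ↔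
    (∀ c ∈ ν, ∀ d ∈ ν, g c.1 c.2 = g d.1 d.2 → c = d) ∧ μ.card ≤ ν.card + 1 := by
  have hs := YoungDiagram.cells_subset_iff.2 h
  have hcard : μ.card ≤ ν.card + 1 ↔ (μ.cells \ ν.cells).card ≤ 1 := by
    have := card_sdiff_add_card_eq_card hs
    simp only [YoungDiagram.card]
    omega
  have hin : ∀ c ∈ ν, extendFilling ν μ n g c.1 c.2 = g c.1 c.2 := fun c hc => by
    simp [extendFilling, hc]
  have hout : ∀ c ∈ μ, c ∉ ν → extendFilling ν μ n g c.1 c.2 = n + 1 := fun c hc hc' => by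
    simp [extendFilling, hc, hc']
  have hle : ∀ c ∈ ν, g c.1 c.2 ≤ n := fun c hc => ((mem_fillings.1 hg).2.2.2 c.1 c.2 hc).2
  rw [hcard, card_le_one]
  simp only [mem_sdiff, YoungDiagram.mem_cells]
  constructor
  · intro H
    refine ⟨fun c hc d hd hcd => H c (h hc) d (h hd) (by rw [hin c hc, hin d hd, hcd]), ?_⟩
    exact fun c hc d hd => H c hc.1 d hd.1 (by rw [hout c hc.1 hc.2, hout d hd.1 hd.2])
  · rintro ⟨H1, H2⟩ c hc d hd hcd
    by_cases hc' : c ∈ ν <;> by_cases hd' : d ∈ ν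
    · rw [hin c hc', hin d hd'] at hcd
      exact H1 c hc' d hd' hcd
    · rw [hin c hc', hout d hd hd'] at hcd
      have := hle c hc'
      omega
    · rw [hout c hc hc', hin d hd'] at hcd
      have := hle d hd'
      omega
    · exact H2 c ⟨hc, hc'⟩ d ⟨hd, hd'⟩

theorem hasInitialColumn_extendFilling_iff {ν μ : YoungDiagram} {n j : ℕ} {g : ℕ → ℕ → ℕ}
    (hj : j ≤ n) (h : ν ≤ μ) (hg : g ∈ fillings ν n) :
    HasInitialColumn j μ (extendFilling ν μ n g) ↔
      HasInitialColumn j ν g ∧ μ.card ≤ ν.card + 1 := by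
  have hv : ∀ v, v ≤ j → ((∃ i, (i, 0) ∈ μ ∧ extendFilling ν μ n g i 0 = v) ↔
      ∃ i, (i, 0) ∈ ν ∧ g i 0 = v) := by
    refine fun v hv => exists_congr fun i => ⟨fun hi => ?_, fun hi => ⟨h hi.1, ?_⟩⟩
    · have hn := (extendFilling_le_iff hg hi.1).1 (by omega)
      refine ⟨hn, ?_⟩
      simpa [extendFilling, hn] using hi.2
    · simpa [extendFilling, hi.1] using hi.2
  rw [HasInitialColumn, injective_extendFilling_iff h hg, HasInitialColumn]
  have : (∀ v, 1 ≤ v → v ≤ j → ∃ i, (i, 0) ∈ μ ∧ extendFilling ν μ n g i 0 = v) ↔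
      ∀ v, 1 ≤ v → v ≤ j → ∃ i, (i, 0) ∈ ν ∧ g i 0 = v :=
    forall_congr' fun v => forall_congr' fun _ => forall_congr' fun h' => hv v h'
  rw [this]
  tauto

/-- The label `n + 1` is unused or occupies one removable cell; as `j ≤ n`, it is not among the
prescribed labels. -/
theorem columnCount_succ (μ : YoungDiagram) {n j : ℕ} (hj : j ≤ n) :
    columnCount μ (n + 1) j = columnCount μ n j + ∑ ν ∈ removeCell μ, columnCount ν n j := by
  classical
  have hset : (strips μ).filter (fun ν => μ.card ≤ ν.card + 1) = insert μ (removeCell μ) := by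
    ext ν
    rw [mem_filter, mem_strips, mem_insert, mem_removeCell]
    constructor
    · rintro ⟨h, h'⟩
      have := card_le_card_of_le h.1
      by_cases hc : μ.card ≤ ν.card
      · exact Or.inl (eq_of_le_of_card_le h.1 hc)
      · exact Or.inr ⟨h.1, by omega⟩
    · rintro (rfl | h)
      · exact ⟨isStrip_refl _, by omega⟩
      · exact ⟨h.isStrip, h.2.le⟩
  rw [columnCount, sum_fillings_succ, ← sum_insert (f := fun ν => columnCount ν n j) (notMem_removeCell_self μ), ← hset, sum_filter]
  refine sum_congr rfl fun ν hν => ?_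
  have hs := mem_strips.1 hν
  rw [columnCount]
  split_ifs with hc
  · refine sum_congr rfl fun g hg => ?_
    simp [hasInitialColumn_extendFilling_iff hj hs.1 hg, hc]
  · refine sum_eq_zero fun g hg => ?_
    simp [hasInitialColumn_extendFilling_iff hj hs.1 hg, hc]

/-- The only standard filling of a column by `1, …, j`. -/
def columnFilling (j : ℕ) : ℕ → ℕ → ℕ := fun a b => if (a, b) ∈ column j then a + 1 else 0

theorem columnFilling_mem (j : ℕ) : columnFilling j ∈ fillings (column j) j := by
  refine mem_fillings.2 ⟨fun i j₁ j₂ hj hm => ?_, fun i₁ i₂ b hi hm => ?_, fun i b hm => ?_,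
    fun i b hm => ?_⟩
  · have := (mem_column.1 hm).2
    omega
  · have hm' := (column j).up_left_mem hi.le le_rfl hm
    simp only [columnFilling, hm, hm', if_true]
    omega
  · simp [columnFilling, hm]
  · have := (mem_column.1 hm).1
    simp only [columnFilling, hm, if_true]
    omega

theorem hasInitialColumn_columnFilling (j : ℕ) :
    HasInitialColumn j (column j) (columnFilling j) := by
  constructor
  · rintro ⟨a, b⟩ hc ⟨a', b'⟩ hd h
    simp only [columnFilling, hc, hd, if_true] at h
    rw [mem_column] at hc hd
    rw [Prod.mk.injEq]
    omega
  · intro v hv hvj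
    have hm : (v - 1, 0) ∈ column j := mem_column.2 ⟨by omega, rfl⟩
    refine ⟨v - 1, hm, ?_⟩
    simp only [columnFilling, hm, if_true]
    omega

theorem HasInitialColumn.eq_column {μ : YoungDiagram} {j : ℕ} {f : ℕ → ℕ → ℕ}
    (h : HasInitialColumn j μ f) (hf : f ∈ fillings μ j) :
    μ = column j ∧ f = columnFilling j := by
  obtain ⟨-, h2, h3, h4⟩ := mem_fillings.1 hf
  obtain ⟨hinj, hcol⟩ := h
  -- If `v` were above row `v - 1`, its cell would already carry a smaller label. If it were below,
  -- the label in row `v - 1` would be smaller than `v`, hence already used in an earlier row.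
  have key : ∀ v, 1 ≤ v → v ≤ j → (v - 1, 0) ∈ μ ∧ f (v - 1) 0 = v := by
    intro v
    induction v using Nat.strong_induction_on with
    | _ v ih =>
      intro hv hvj
      obtain ⟨i, hi, hfi⟩ := hcol v hv hvj
      rcases lt_trichotomy i (v - 1) with hlt | heq | hgt
      · have := (ih (i + 1) (by omega) (by omega) (by omega)).2
        simp only [Nat.add_sub_cancel] at this
        omega
      · subst heq
        exact ⟨hi, hfi⟩
      · have hm := μ.up_left_mem hgt.le le_rfl hi
        have h5 := h2 _ _ _ hgt hi
        have h6 := h4 _ _ hm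
        obtain ⟨h7, h8⟩ := ih (f (v - 1) 0) (by omega) h6.1 h6.2
        have := congrArg Prod.fst (hinj _ h7 _ hm h8)
        dsimp only at this
        omega
  -- Every available label is already placed in the first column, so injectivity excludes further
  -- cells.
  have hcell : ∀ a b, (a, b) ∈ μ → b = 0 ∧ a < j ∧ f a b = a + 1 := by
    intro a b hab
    have h5 := h4 a b hab
    obtain ⟨h6, h7⟩ := key _ h5.1 h5.2
    have h8 := Prod.mk.inj (hinj _ h6 _ hab h7)
    omega
  have hμ : μ = column j := by
    refine diagram_ext fun a b => ?_
    rw [mem_column]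
    constructor
    · intro hab
      have := hcell a b hab
      exact ⟨this.2.1, this.1⟩
    · rintro ⟨ha, rfl⟩
      simpa using (key (a + 1) (by omega) (by omega)).1
  refine ⟨hμ, ?_⟩
  funext a b
  by_cases hab : (a, b) ∈ μ
  · rw [(hcell a b hab).2.2, columnFilling, if_pos (hμ ▸ hab)]
  · rw [h3 a b hab, columnFilling, if_neg (hμ ▸ hab)]

open scoped Classical in
theorem columnCount_self (μ : YoungDiagram) (j : ℕ) :
    columnCount μ j j = if μ = column j then 1 else 0 := by
  rw [columnCount]
  split_ifs with h
  · subst h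
    rw [sum_eq_single_of_mem _ (columnFilling_mem j), if_pos (hasInitialColumn_columnFilling j)]
    exact fun f hf hne => if_neg fun h => hne (h.eq_column hf).2
  · exact sum_eq_zero fun f hf => if_neg fun h' => h (h'.eq_column hf).1

/-! ### Generating function of the column counts -/

section Coefficients

variable {R : Type*} [CommRing R]

/-- Induction on the number `n` of labels, with the number `N` of variables fixed. At `n = j` only
the column of length `j` survives; each further label multiplies the generating function by `1 + p
X`, by `columnCount_succ` and the Pieri rule. -/
theorem sum_columnCount_mul_schurSum (x : ℕ → R) (N : ℕ) {n j : ℕ} (hj : j ≤ n) : ∀ k,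
    ∑ μ ∈ partitions k, (columnCount μ n j : R) * schurSum x μ N =
      (Polynomial.C ((elemGen x N).coeff j) * Polynomial.X ^ j *
        (1 + Polynomial.C (∑ i ∈ range N, x (i + 1)) * Polynomial.X) ^ (n - j)).coeff k := by
  classical
  induction n, hj using Nat.le_induction with
  | base =>
    intro k
    rw [Nat.sub_self, pow_zero, mul_one, Polynomial.coeff_C_mul_X_pow, ← schurSum_column]
    simp only [columnCount_self, Nat.cast_ite, Nat.cast_one, Nat.cast_zero, ite_mul, one_mul,
      zero_mul, sum_ite_eq', mem_partitions, card_column]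
    simp only [eq_comm]
  | succ n hj ih =>
    intro k
    rw [Nat.sub_add_comm hj, pow_succ, ← mul_assoc]
    simp only [columnCount_succ _ hj, Nat.cast_add, add_mul, sum_add_distrib, ih]
    rcases k with _ | k
    · rw [coeff_mul_one_add_C_mul_X_zero, add_eq_left]
      refine sum_eq_zero fun μ hμ => ?_
      rw [mem_partitions] at hμ
      rw [show removeCell μ = ∅ from eq_empty_of_forall_notMem fun ν hν => by
        have := (mem_removeCell.1 hν).2
        omega]
      simp
    · rw [coeff_mul_one_add_C_mul_X_succ, add_right_inj, ← ih, mul_sum]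
      have : ∀ ν, (∑ i ∈ range N, x (i + 1)) * ((columnCount ν n j : R) * schurSum x ν N) =
          ∑ μ ∈ addCell ν, (columnCount ν n j : R) * schurSum x μ N := fun ν => by
        rw [mul_left_comm, sum_mul_schurSum, mul_sum]
      simp only [this, Nat.cast_sum, sum_mul]
      refine sum_comm' fun μ ν => ?_
      rw [mem_partitions, mem_partitions, mem_removeCell, mem_addCell]
      constructor
      · rintro ⟨h, h'⟩
        have := h'.2
        exact ⟨h', by omega⟩
      · rintro ⟨h, h'⟩
        have := h.2
        exact ⟨by omega, h⟩

end Coefficients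

/-! ### Parity tableaux -/

open scoped Classical in
theorem ncard_parityTableaux (μ : YoungDiagram) (n : ℕ) :
    ((parityTableaux μ n).ncard : ℤ) =
      ∑ j ∈ range (n + 1), (-1) ^ j * (columnCount μ n j : ℤ) := by
  have h1 : (parityTableaux μ n).ncard =
      ∑ T ∈ (SSYT_finite μ n).toFinset, if T ∈ parityTableaux μ n then 1 else 0 := by
    rw [← card_filter, ← Set.ncard_coe_finset]
    congr 1
    ext T
    simp only [coe_filter, Set.Finite.mem_toFinset, Set.mem_ofPred_eq]
    exact ⟨fun h => ⟨h.1.1, h⟩, fun h => h.2⟩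
  simp only [h1, columnCount, sum_fillings, Nat.cast_sum, mul_sum]
  rw [sum_comm]
  refine sum_congr rfl fun T hT => ?_
  rw [Set.Finite.mem_toFinset] at hT
  by_cases hinj : ∀ c ∈ μ, ∀ d ∈ μ, T c.1 c.2 = T d.1 d.2 → c = d
  · have hSYT : T ∈ SYT μ n := by
      -- Distinct labels make weakly increasing rows strict, so the last condition of `SYT` is
      -- automatic.
      refine ⟨hT, hinj, fun i j₁ j₂ hj hm => lt_of_le_of_ne (T.row_weak hj hm) fun he => ?_⟩
      have := congrArg Prod.snd (hinj _ (μ.up_left_mem le_rfl hj.le hm) _ hm he)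
      exact hj.ne this
    have hne : n + 1 ∈ missingFirstColumn T := by
      refine ⟨by omega, fun i hi he => ?_⟩
      have := (hT i 0 hi).2
      omega
    obtain ⟨m, hm⟩ : ∃ m, IsLeast (missingFirstColumn T) m :=
      ⟨_, Nat.sInf_mem ⟨_, hne⟩, fun _ h => Nat.sInf_le h⟩
    have hpar : T ∈ parityTableaux μ n ↔ Odd m :=
      ⟨fun ⟨_, m', hm', ho⟩ => hm.unique hm' ▸ ho, fun ho => ⟨hSYT, m, hm, ho⟩⟩
    have hinit : ∀ j, HasInitialColumn j μ T ↔ j < m := by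
      intro j
      constructor
      · rintro ⟨-, h⟩
        by_contra hjm
        obtain ⟨i, hi, he⟩ := h m hm.1.1 (not_lt.1 hjm)
        exact hm.1.2 i hi he
      · refine fun hjm => ⟨hinj, fun v hv hvj => ?_⟩
        by_contra hc
        push Not at hc
        have := hm.2 (show v ∈ missingFirstColumn T from ⟨hv, hc⟩)
        omega
    -- This bound ensures that `j ≤ n` covers every `j < m`, so the alternating sum is complete.
    have hmn : m ≤ n + 1 := hm.2 hne
    simp only [hpar, hinit, Nat.cast_ite, Nat.cast_one, Nat.cast_zero, mul_ite, mul_one, mul_zero]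
    rw [← sum_filter, show (range (n + 1)).filter (· < m) = range m from ?_, neg_one_geom_sum]
    · simp only [← Nat.not_even_iff_odd, ite_not]
    · ext j
      simp only [mem_filter, mem_range]
      omega
  · have hpar : T ∉ parityTableaux μ n := fun h => hinj h.1.2.1
    have hinit : ∀ j, ¬ HasInitialColumn j μ T := fun j h => hinj h.1
    simp [hpar, hinit]

/-! ### Schur polynomials as Schur sums -/

theorem aeval_schur {R : Type*} [CommRing R] [Algebra ℤ R] (μ : YoungDiagram) {n : ℕ} {x : ℕ → R}
    {y : Fin n → R} (h : ∀ i : Fin n, x (i + 1) = y i) :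
    MvPolynomial.aeval y (schur μ n) = schurSum x μ n := by
  rw [schur, schurSum, sum_fillings, map_sum]
  refine sum_congr rfl fun T hT => ?_
  rw [Set.Finite.mem_toFinset] at hT
  have hb : ∀ c ∈ μ.cells, 1 ≤ T c.1 c.2 ∧ T c.1 c.2 ≤ n := fun c hc =>
    hT c.1 c.2 ((YoungDiagram.mem_cells c).1 hc)
  -- Cells are grouped by label, shifted by one to match `Fin n`; labels are positive, so the
  -- subtraction loses nothing.
  rw [map_prod, ← prod_fiberwise_of_maps_to (s := μ.cells) (t := range n)
    (g := fun c => T c.1 c.2 - 1) fun c hc => mem_range.2 (by have := hb c hc; omega), prod_range]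
  refine prod_congr rfl fun i _ => ?_
  rw [map_pow, MvPolynomial.aeval_X, ← h, wt]
  have hfil : μ.cells.filter (fun c => T c.1 c.2 = (i : ℕ) + 1) =
      μ.cells.filter (fun c => T c.1 c.2 - 1 = (i : ℕ)) :=
    filter_congr fun c hc => by have := hb c hc; omega
  rw [hfil]
  refine (prod_eq_pow_card fun c hc => ?_).symm
  rw [mem_filter] at hc
  have := hb c hc.1
  congr 1
  omega

end ChernPlethysm

open Finset ChernPlethysm in
theorem theorem3p2 (n k : ℕ) :
    ChernPlethysm.schurBar (ChernPlethysm.column k) n =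
      ∑ μ ∈ ChernPlethysm.partitions k,
        ((ChernPlethysm.parityTableaux μ n).ncard : MvPolynomial (Fin n) ℤ) *
          ChernPlethysm.schur μ n := by
  -- The variables indexed from `1`, as the labels are; the values at `0` and beyond `n` play no
  -- role.
  let x : ℕ → MvPolynomial (Fin n) ℤ := fun m =>
    if h : m - 1 < n then MvPolynomial.X ⟨m - 1, h⟩ else 0
  have hx : ∀ i : Fin n, x (i + 1) = MvPolynomial.X i := fun i => by simp [x]
  set p : MvPolynomial (Fin n) ℤ := ∑ i ∈ range n, x (i + 1) with hp
  have hpX : ∑ j : Fin n, MvPolynomial.X j = p := by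
    rw [hp, sum_range]
    exact sum_congr rfl fun i _ => (hx i).symm
  have hschur : ∀ μ, schur μ n = schurSum x μ n := fun μ => by
    rw [← aeval_schur μ hx, MvPolynomial.aeval_X_left_apply]
  have hcount : ∀ μ, ((parityTableaux μ n).ncard : MvPolynomial (Fin n) ℤ) =
      ∑ j ∈ range (n + 1), (-1) ^ j * (columnCount μ n j : MvPolynomial (Fin n) ℤ) := fun μ => by
    have := congrArg (Int.cast : ℤ → MvPolynomial (Fin n) ℤ) (ncard_parityTableaux μ n)
    push_cast at this
    exact this
  have hgen : elemGen (fun m => p - x m) n = ∑ j ∈ range (n + 1),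
      Polynomial.C ((-1) ^ j) * (Polynomial.C ((elemGen x n).coeff j) * Polynomial.X ^ j *
        (1 + Polynomial.C p * Polynomial.X) ^ (n - j)) := by
    -- Each factor `1 + (p - x_i) X` is split as `(1 + p X) + x_i (-X)`; the sign `(-1)^j` comes
    -- from `(-X)^j`.
    have := prod_add_C_mul x n (1 + Polynomial.C p * Polynomial.X) (-Polynomial.X)
    rw [elemGen]
    refine (prod_congr rfl fun i _ => ?_).trans (this.trans (sum_congr rfl fun j _ => ?_))
    · rw [Polynomial.C_sub]
      ring
    · rw [neg_pow, Polynomial.C_pow, Polynomial.C_neg, Polynomial.C_1]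
      ring
  rw [schurBar, aeval_schur (x := fun m => p - x m) (column k) (fun i => by rw [hpX, hx]),
    schurSum_column, hgen, Polynomial.finsetSum_coeff]
  simp only [hschur, hcount, sum_mul]
  rw [sum_comm]
  refine sum_congr rfl fun j hj => ?_
  rw [Polynomial.coeff_C_mul,
    ← sum_columnCount_mul_schurSum x n (Nat.lt_succ_iff.1 (mem_range.1 hj)), mul_sum]
  exact sum_congr rfl fun μ _ => (mul_assoc _ _ _).symm
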